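/- Let $\Sigma$ and $\Gamma$ be finite alphabets. **Definitions.** A *streaming setting* $\mathfrak C$ with output set $X$ is a category $\mathcal C$ with two objects $\top$, $\bot$ and a map $\mathrm{Hom}_{\mathcal C}(\top,\bot)\to X$. A *state-dependent-memory $\mathfrak C$-SST* (sdm-$\mathfrak C$-SST) with input alphabet $\Sigma$ consists of a finite set $Q$ of states, an initial state $q_0\in Q$, objects $(C_q)_{q\in Q}$ of $\mathcal C$, a transition function $\delta:\Sigma\to\prod_{q\in Q}\sum_{r\in Q}\mathrm{Hom}_{\mathcal C}(C_q,C_r)$, an initial morphism $i:\top\to C_{q_0}$ and output morphisms $o_q:C_q\to\bot$ $(q\in Q)$. It computes a function $\Sigma^*\to X$: on an input word $w$ it runs deterministically from $q_0$, and its output is the image in $X$ of the composite of $i$, of the transition morphisms met along the run, and of the output morphism of the last state. In a *partial* sdm-$\mathfrak C$-SST the family $o$ may be partial, and the computed function is then partial. A *non-deterministic* sdm-$\mathfrak C$-SST has instead of $q_0$ and $i$ a set $I\subseteq Q$ of initial states with morphisms $i_q:\top\to C_q$ $(q\in I)$, instead of $\delta$ a finite set of transitions $(a,q,r,f)$ with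 $a\in\Sigma$, $q,r\in Q$, $f:C_q\to C_r$, and a partial family $o$; it maps a word to the set of outputs of all its runs that end in a state where $o$ is defined. A partial function $f$ *uniformizes* a set-valued function $F$ if $f(w)$ is defined exactly when $F(w)\neq\varnothing$, and then $f(w)\in F(w)$. The streaming setting $\mathcal{SR}$ with output $\Gamma^*$ has finite sets (of registers) as objects; the morphisms $R\to S$ are the copyless register transitions, i.e. the maps $t:S\to(\Gamma+R)^*$ such that each $r\in R$ occurs at most once in all the words $t(s)$ together; composition is by substitution; $\top=\varnothing$, $\bot=\{\bullet\}$, and a morphism $\varnothing\to\{\bullet\}$ is sent to the word of $\Gamma^*$ that it is. The streaming setting $\mathcal{SR}_\&$ is its free finite product completion: the objects are finite families $(C_x)_{x\in X}$ of objects of $\mathcal{SR}$, with $\mathrm{Hom}((C_x)_{x\in X},(D_y)_{y\in Y})=\prod_{y\in Y}\sum_{x\in X}\mathrm{Hom}_{\mathcal{SR}}(C_x,D_y)$, and $\top$, $\bot$ are the corresponding one-element families. **Theorem.** 1. Sdm-$\mathcal{SR}_\&$-SSTs are subsumed by sdm-$\mathcal{SR}$-SSTs: every function $\Sigma^*\to\Gamma^*$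 computed by an sdm-$\mathcal{SR}_\&$-SST is computed by an sdm-$\mathcal{SR}$-SST. 2. Every such function is even computed by an ordinary deterministic copyless streaming string transducer with input alphabet $\Sigma$ and output alphabet $\Gamma$ (finitely many states, one fixed finite set of $\Gamma^*$-valued registers, copyless register updates). 3. (Uniformization.) For every non-deterministic sdm-$\mathcal{SR}$-SST there is a partial deterministic sdm-$\mathcal{SR}$-SST with the same register set at all of its states (that is, a partial deterministic copyless SST) whose partial function uniformizes the set-valued function of the given machine. -/

import Mathlib

open CategoryTheory

universe u v w w'

set_option linter.checkUnivs false

/-! ## Streaming settings and state-dependent memory SSTs -/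

/-- A string streaming setting with output set `X`: a category with two distinguished objects and
a map sending the morphisms between them to outputs. -/
structure StreamingSetting (X : Type w) where
  Obj : Type u
  [cat : Category.{v} Obj]
  /-- The object in which memories are initialized. -/
  start : Obj
  /-- The object from which outputs are read. -/
  final : Obj
  interp : (start ⟶ final) → X

attribute [instance] StreamingSetting.cat

/-- A (deterministic, total) state-dependent memory SST over the streaming setting `𝔠`, with input
alphabet `A`. -/
structure SdmSST {X : Type w} (𝔠 : StreamingSetting.{u, v, w} X) (A : Type w') where
  State : Type
  [finite_state : Finite State]
  init : State
  mem : State → 𝔠.Obj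
  trans : A → (q : State) → (Σ r : State, (mem q ⟶ mem r))
  initMor : 𝔠.start ⟶ mem init
  outMor : (q : State) → (mem q ⟶ 𝔠.final)

namespace SdmSST

attribute [instance] SdmSST.finite_state

variable {X : Type w} {𝔠 : StreamingSetting.{u, v, w} X} {A : Type w'}

/-- A configuration: the current state, together with the composite of the initialization
morphism and of the transition morphisms used so far. -/
abbrev Config (T : SdmSST 𝔠 A) := Σ q : T.State, (𝔠.start ⟶ T.mem q)

def step (T : SdmSST 𝔠 A) (c : T.Config) (a : A) : T.Config :=
  ⟨(T.trans a c.1).1, c.2 ≫ (T.trans a c.1).2⟩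

def run (T : SdmSST 𝔠 A) (w : List A) : T.Config :=
  w.foldl T.step ⟨T.init, T.initMor⟩

/-- The function `A* → X` computed by the transducer. -/
def eval (T : SdmSST 𝔠 A) (w : List A) : X :=
  𝔠.interp ((T.run w).2 ≫ T.outMor (T.run w).1)

end SdmSST

/-- Partial deterministic sdmSSTs: as `SdmSST`, except that the output morphisms are partial. -/
structure PartialSdmSST {X : Type w} (𝔠 : StreamingSetting.{u, v, w} X) (A : Type w') where
  State : Type
  [finite_state : Finite State]
  init : State
  mem : State → 𝔠.Obj
  trans : A → (q : State) → (Σ r : State, (mem q ⟶ mem r))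
  initMor : 𝔠.start ⟶ mem init
  outMor : (q : State) → Option (mem q ⟶ 𝔠.final)

namespace PartialSdmSST

attribute [instance] PartialSdmSST.finite_state

variable {X : Type w} {𝔠 : StreamingSetting.{u, v, w} X} {A : Type w'}

abbrev Config (T : PartialSdmSST 𝔠 A) := Σ q : T.State, (𝔠.start ⟶ T.mem q)

def step (T : PartialSdmSST 𝔠 A) (c : T.Config) (a : A) : T.Config :=
  ⟨(T.trans a c.1).1, c.2 ≫ (T.trans a c.1).2⟩

def run (T : PartialSdmSST 𝔠 A) (w : List A) : T.Config :=
  w.foldl T.step ⟨T.init, T.initMor⟩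

/-- The partial function `A* ⇀ X` computed by the transducer. -/
def eval (T : PartialSdmSST 𝔠 A) (w : List A) : Option X :=
  (T.outMor (T.run w).1).map fun g => 𝔠.interp ((T.run w).2 ≫ g)

/-- The memory object is the same at all states. -/
def ConstMemory (T : PartialSdmSST 𝔠 A) : Prop :=
  ∃ R : 𝔠.Obj, ∀ q, T.mem q = R

end PartialSdmSST

/-- Non-deterministic sdmSSTs, with finitely many transitions and partial output morphisms. -/
structure NondetSdmSST {X : Type w} (𝔠 : StreamingSetting.{u, v, w} X) (A : Type w') where
  State : Type
  [finite_state : Finite State]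
  init : Set State
  mem : State → 𝔠.Obj
  trans : Set (A × (Σ p : State × State, (mem p.1 ⟶ mem p.2)))
  finite_trans : trans.Finite
  initMor : (q : init) → (𝔠.start ⟶ mem q)
  outMor : (q : State) → Option (mem q ⟶ 𝔠.final)

namespace NondetSdmSST

attribute [instance] NondetSdmSST.finite_state

variable {X : Type w} {𝔠 : StreamingSetting.{u, v, w} X} {A : Type w'}

abbrev Config (T : NondetSdmSST 𝔠 A) := Σ q : T.State, (𝔠.start ⟶ T.mem q)

/-- The configurations reachable by reading `a` from a configuration in `S`. -/
def step (T : NondetSdmSST 𝔠 A) (S : Set T.Config) (a : A) : Set T.Config :=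
  {c' | ∃ c ∈ S, ∃ g : T.mem c.1 ⟶ T.mem c'.1,
    (a, ⟨(c.1, c'.1), g⟩) ∈ T.trans ∧ c'.2 = c.2 ≫ g}

/-- The configurations in which some run on `w` from an initial state ends. -/
def run (T : NondetSdmSST 𝔠 A) (w : List A) : Set T.Config :=
  w.foldl T.step (Set.range fun q : T.init => ⟨q, T.initMor q⟩)

/-- The set of outputs of all runs on `w`. -/
def eval (T : NondetSdmSST 𝔠 A) (w : List A) : Set X :=
  {x | ∃ c ∈ T.run w, ∃ g, T.outMor c.1 = some g ∧ x = 𝔠.interp (c.2 ≫ g)}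

end NondetSdmSST

/-- The partial function `f` uniformizes `F`: the domain of `f` is the set of points where `F` is
non-empty, and `f` selects an element of `F` on its domain. -/
def Uniformizes {α : Type*} {β : Type*} (f : α → Option β) (F : α → Set β) : Prop :=
  (∀ a, (f a).isSome ↔ (F a).Nonempty) ∧ ∀ a b, f a = some b → b ∈ F a

/-! ## The free finite product completion -/

/-- Objects of the free finite product completion: formal finite products of objects of `C`. -/
structure FreeProd (C : Type u) where
  Idx : Type
  [finite_idx : Finite Idx]
  obj : Idx → C

namespace FreeProd

attribute [instance] FreeProd.finite_idx

/-- `Hom(&_x C_x, &_y D_y) = ∏_y ∑_x Hom(C_x, D_y)`. This is the opposite of the free finite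
coproduct completion of `Cᵒᵖ`. -/
instance category (C : Type u) [Category.{v} C] : Category (FreeProd C) where
  Hom P P' := (y : P'.Idx) → (Σ x : P.Idx, (P.obj x ⟶ P'.obj y))
  id _ := fun y => ⟨y, 𝟙 _⟩
  comp f g := fun z => ⟨(f (g z).1).1, (f (g z).1).2 ≫ (g z).2⟩

/-- The one-element family. -/
def incl {C : Type u} (c : C) : FreeProd C where
  Idx := Unit
  obj _ := c

end FreeProd

/-- The extension of the free finite product completion to streaming settings. -/
def StreamingSetting.withProd {X : Type w} (𝔠 : StreamingSetting.{u, v, w} X) :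
    StreamingSetting X where
  Obj := FreeProd 𝔠.Obj
  start := FreeProd.incl 𝔠.start
  final := FreeProd.incl 𝔠.final
  interp f := 𝔠.interp (f ()).2

/-! ## Copyless register transitions -/

open Classical in
/-- The number of occurrences of the register `r` in a word. -/
noncomputable def occ {B : Type w} {R : Type} (r : R) (l : List (B ⊕ R)) : ℕ :=
  l.countP fun x => x = Sum.inr r

/-- A copyless `B`-register transition from `R` to `S`: a map `S → (B + R)*` such that every
`r : R` occurs at most once among all the words in its image. -/
@[ext]
structure RegTransition (B : Type w) (R S : Type) [Fintype S] where
  toFun : S → List (B ⊕ R)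
  copyless : ∀ r : R, ∑ s : S, occ r (toFun s) ≤ 1

namespace RegTransition

variable {B : Type w} {R S T : Type}

/-- The action of a register transition on tuples of strings. -/
def act [Fintype S] (t : RegTransition B R S) (x : R → List B) (s : S) : List B :=
  (t.toFun s).flatMap (Sum.elim (fun c => [c]) x)

/-- The monoid morphism `(B + S)* → (B + R)*` that replaces each `s : S` by the word `t s`. -/
def subst (t : S → List (B ⊕ R)) (l : List (B ⊕ S)) : List (B ⊕ R) :=
  l.flatMap (Sum.elim (fun c => [Sum.inl c]) t)

theorem occ_subst [Fintype S] (t : S → List (B ⊕ R)) (r : R) (l : List (B ⊕ S)) :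
    occ r (subst t l) = ∑ s : S, occ s l * occ r (t s) := by
  classical
  induction l with
  | nil => simp [subst, occ]
  | cons x l ih =>
    have h : subst t (x :: l) =
        Sum.elim (fun c => [Sum.inl c]) t x ++ subst t l := by simp [subst]
    have happ : ∀ l₁ l₂ : List (B ⊕ R), occ r (l₁ ++ l₂) = occ r l₁ + occ r l₂ := by
      intro l₁ l₂; simp [occ]
    rw [h, happ, ih]
    rcases x with c | s
    · simp [occ]
    · have h1 : ∀ s' : S, occ s' ((Sum.inr s : B ⊕ S) :: l) =
          occ s' l + if s = s' then 1 else 0 := by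
        intro s'; simp [occ, List.countP_cons]
      simp [h1, add_mul, Finset.sum_add_distrib, add_comm]

def id (B : Type w) (R : Type) [Fintype R] : RegTransition B R R where
  toFun r := [Sum.inr r]
  copyless r := by
    classical
    have h : ∀ s : R, occ r [(Sum.inr s : B ⊕ R)] = if s = r then 1 else 0 := by
      intro s; simp [occ, List.countP_cons]
    simp [h]

/-- Composition of copyless register transitions, in diagrammatic order. -/
def comp [Fintype S] [Fintype T] (t : RegTransition B R S) (t' : RegTransition B S T) :
    RegTransition B R T where
  toFun u := subst t.toFun (t'.toFun u)
  copyless r := by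
    simp only [occ_subst]
    rw [Finset.sum_comm]
    simp only [← Finset.sum_mul]
    calc ∑ s : S, (∑ u : T, occ s (t'.toFun u)) * occ r (t.toFun s)
        ≤ ∑ s : S, 1 * occ r (t.toFun s) :=
          Finset.sum_le_sum fun s _ => Nat.mul_le_mul_right _ (t'.copyless s)
      _ ≤ 1 := by simpa using t.copyless r

end RegTransition

/-- Objects of the category of copyless register transitions: finite sets of registers. -/
structure RegSet (B : Type w) where
  regs : Type
  [fintype_regs : Fintype regs]

attribute [instance] RegSet.fintype_regs

namespace RegSet

instance category (B : Type w) : Category (RegSet B) where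
  Hom R S := RegTransition B R.regs S.regs
  id R := RegTransition.id B R.regs
  comp t t' := t.comp t'
  id_comp {R S} t := by
    refine RegTransition.ext (funext fun s => ?_)
    have h : (Sum.elim (fun c => [Sum.inl c]) fun r => [Sum.inr r]) =
        fun x : B ⊕ R.regs => [x] := by
      funext x; rcases x with c | r <;> rfl
    simp [RegTransition.comp, RegTransition.id, RegTransition.subst, h]
  comp_id t := by
    refine RegTransition.ext (funext fun s => ?_)
    simp [RegTransition.comp, RegTransition.id, RegTransition.subst]
  assoc t t' t'' := by
    refine RegTransition.ext (funext fun s => ?_)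
    simp only [RegTransition.comp, RegTransition.subst, List.flatMap_assoc]
    congr 1
    funext x
    rcases x with c | r <;> simp

end RegSet

/-- The streaming setting `SR(B)` of copyless register transitions, with output `B*`. -/
def SR (B : Type w) : StreamingSetting (List B) where
  Obj := RegSet B
  start := ⟨Empty⟩
  final := ⟨Unit⟩
  interp t := (RegTransition.toFun t ()).map (Sum.elim _root_.id Empty.elim)

/-! ## Ordinary copyless SSTs -/

/-- A (deterministic) copyless streaming string transducer with input alphabet `A` and output
alphabet `B`. -/
structure CopylessSST (A : Type w') (B : Type w) where
  State : Type
  [finite_state : Finite State]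
  init : State
  Reg : Type
  [fintype_reg : Fintype Reg]
  trans : A → State → State × RegTransition B Reg Reg
  initReg : RegTransition B Empty Reg
  out : State → RegTransition B Reg Unit

namespace CopylessSST

attribute [instance] CopylessSST.finite_state CopylessSST.fintype_reg

variable {A : Type w'} {B : Type w}

/-- One step on a pair of a state and a register valuation. -/
def step (T : CopylessSST A B) (c : T.State × (T.Reg → List B)) (a : A) :
    T.State × (T.Reg → List B) :=
  ((T.trans a c.1).1, (T.trans a c.1).2.act c.2)

def run (T : CopylessSST A B) (w : List A) : T.State × (T.Reg → List B) :=
  w.foldl T.step (T.init, T.initReg.act Empty.elim)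

/-- The function `A* → B*` computed by the transducer. -/
def eval (T : CopylessSST A B) (w : List A) : List B :=
  (T.out (T.run w).1).act (T.run w).2 ()

end CopylessSST

/-! ## Generalities on lists and words with registers -/

/-! Everything reduces to uniformizing a non-deterministic machine by an ordinary copyless SST
(`NondetSdmSST.exists_copylessSST`). A morphism between formal products picks one source component
for each target component. A machine with products can therefore be simulated by guessing the
component that will contribute to the output; the guesses that end in an output all give the same
word (`SdmSST.eval_toNondet`), so uniformizing this machine recovers the function.

Uniformization separates finding a run from executing it. To find one, transitions are treated as
mere letters. A deterministic machine tracks the reachable states and, for each of them, one run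
leading to it. These runs share segments and registers cannot be copied, so each segment is stored
once, in a register indexed by the set of all states whose branch contains it. If reading a letter
extends the branch of `p r` to `r`, the content of register `D` moves to register `p⁻¹(D)`: each
register has a single destination, so the update is copyless. The branch of `q` is read off by
concatenating, larger sets before smaller, the registers of the sets containing `q`
(`exists_copylessSST_labelledRun`).

To execute the run, its transitions are first placed on one common register set. A copyless
transition of a finite set `R` amounts to an arrangement of registers, with finitely many
possibilities, and a family of words indexed by `R ⊕ R`. Keeping the arrangements in the state and
the words in registers, a copyless SST composes the transitions instead of storing them
(`CopylessSST.exists_eval_eq_act_prod`). -/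

theorem List.flatMap_filter_fiber {α β : Type*} [LinearOrder α] [LinearOrder β] (g : α → β)
    {s : List α} {K : List β} (hs : s.Pairwise (· < ·)) (hK : K.Pairwise (· < ·))
    (hg : ∀ i ∈ s, ∀ j ∈ s, i ≤ j → g i ≤ g j) (hmem : ∀ i ∈ s, g i ∈ K) :
    K.flatMap (fun k => s.filter fun i => g i = k) = s := by
  have h1 : (K.flatMap fun k => s.filter fun i => g i = k).Pairwise (· < ·) := by
    rw [List.pairwise_flatMap]
    refine ⟨fun k _ => hs.filter _, hK.imp fun {k k'} hkk' i hi j hj => ?_⟩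
    simp only [List.mem_filter, decide_eq_true_eq] at hi hj
    by_contra! hji
    have := hg j hj.1 i hi.1 hji
    rw [hi.2, hj.2] at this
    exact absurd hkk' this.not_gt
  -- By monotonicity of `g` the concatenated fibres are strictly increasing; strictly increasing
  -- lists with the same members are equal.
  refine List.Perm.eq_of_pairwise (le := (· < ·)) (fun a b _ _ hab hba => absurd hab hba.not_gt)
    h1 hs ((List.perm_ext_iff_of_nodup (h1.imp fun h => h.ne) (hs.imp fun h => h.ne)).2 ?_)
  intro i
  simp only [List.mem_flatMap, List.mem_filter, decide_eq_true_eq]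
  exact ⟨fun ⟨_, _, h, _⟩ => h, fun h => ⟨g i, hmem i h, h, rfl⟩⟩

theorem List.flatMap_append_of_last {α β : Type*} [LinearOrder α] (f l : α → List β) {j : α} :
    ∀ {K : List α}, K.Pairwise (· < ·) → j ∈ K → (∀ i ∈ K, i ≤ j) → (∀ i ∈ K, i ≠ j → l i = []) →
      K.flatMap (fun i => f i ++ l i) = K.flatMap f ++ l j
  | [], _, h, _, _ => by simp at h
  | k :: K, hK, hj, hle, hl => by
    rw [List.pairwise_cons] at hK
    by_cases hkj : k = j
    · subst hkj
      have : K = [] := List.eq_nil_iff_forall_not_mem.2 fun i hi =>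
        absurd (hK.1 i hi) (hle i (List.mem_cons_of_mem _ hi)).not_gt
      simp [this]
    · have hj' : j ∈ K := (List.mem_cons.1 hj).resolve_left (Ne.symm hkj)
      have ih := flatMap_append_of_last f l hK.2 hj' (fun i hi => hle i (List.mem_cons_of_mem _ hi))
        (fun i hi => hl i (List.mem_cons_of_mem _ hi))
      simp [ih, hl k List.mem_cons_self hkj]

theorem List.flatMap_filter_ne_nil {α β : Type*} (p : α → Prop) [DecidablePred p]
    (f : α → List β) [DecidablePred fun i => f i ≠ []] (l : List α) :
    (l.filter fun i => p i ∧ f i ≠ []).flatMap f = (l.filter p).flatMap f := by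
  induction l with
  | nil => rfl
  | cons a l ih =>
    by_cases hp : p a <;> by_cases hf : f a = [] <;> simp_all

/-- The subsets of a finite type can be enumerated so that smaller sets come later. -/
theorem exists_enum_set (Q : Type*) [Finite Q] :
    ∃ (n : ℕ) (D : Fin n → Set Q), D.Bijective ∧ ∀ i j, D i ⊆ D j → j ≤ i := by
  classical
  have := Fintype.ofFinite Q
  have : Fintype (LinearExtension (Set Q)ᵒᵈ) := inferInstanceAs (Fintype (Set Q))
  let e := Fintype.orderIsoFinOfCardEq (LinearExtension (Set Q)ᵒᵈ) rfl
  let D : Fin _ → Set Q := fun i => OrderDual.ofDual (show (Set Q)ᵒᵈ from e i)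
  refine ⟨_, D, e.bijective, fun i j h => ?_⟩
  have hle : toLinearExtension (OrderDual.toDual (D j)) ≤
    toLinearExtension (OrderDual.toDual (D i)) := toLinearExtension.monotone h
  exact e.le_iff_le.1 hle

/-! ### Occurrence counts and the action of words with registers -/

section Occ

variable {B : Type w} {R S : Type}

@[simp]
theorem occ_nil (r : R) : occ r ([] : List (B ⊕ R)) = 0 := by simp [occ]

@[simp]
theorem occ_append (r : R) (l l' : List (B ⊕ R)) : occ r (l ++ l') = occ r l + occ r l' := by
  simp [occ]

@[simp]
theorem occ_map_inl (r : R) (l : List B) : occ r (l.map (Sum.inl : B → B ⊕ R)) = 0 := by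
  simp [occ, List.countP_eq_zero]

@[simp]
theorem occ_cons_inl (r : R) (b : B) (l : List (B ⊕ R)) : occ r (Sum.inl b :: l) = occ r l := by
  simp [occ]

open Classical in
@[simp]
theorem occ_cons_inr (r s : R) (l : List (B ⊕ R)) :
    occ r (Sum.inr s :: l) = occ r l + if s = r then 1 else 0 := by
  simp [occ, List.countP_cons]

theorem occ_map_inr [DecidableEq R] (r : R) (l : List R) :
    occ r (l.map (Sum.inr : R → B ⊕ R)) = l.count r := by
  induction l with
  | nil => simp
  | cons a l ih => simp [ih, List.count_cons]

/-- The action of a word with registers on a register valuation. -/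
def actWord (x : R → List B) (l : List (B ⊕ R)) : List B :=
  l.flatMap (Sum.elim (fun c => [c]) x)

@[simp]
theorem actWord_append (x : R → List B) (l l' : List (B ⊕ R)) :
    actWord x (l ++ l') = actWord x l ++ actWord x l' := by simp [actWord]

@[simp]
theorem actWord_map_inl (x : R → List B) (l : List B) : actWord x (l.map Sum.inl) = l := by
  simp [actWord, List.flatMap_map]

@[simp]
theorem actWord_map_inr (x : R → List B) (l : List R) :
    actWord x (l.map Sum.inr) = l.flatMap x := by
  simp [actWord, List.flatMap_map]

theorem RegTransition.act_apply [Fintype S] (t : RegTransition B R S) (x : R → List B) (s : S) :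
    t.act x s = actWord x (t.toFun s) := rfl

theorem actWord_subst (x : R → List B) (t : S → List (B ⊕ R)) (l : List (B ⊕ S)) :
    actWord x (RegTransition.subst t l) = actWord (fun s => actWord x (t s)) l := by
  simp only [actWord, RegTransition.subst, List.flatMap_assoc]
  congr 1
  funext y
  rcases y with c | s <;> simp

end Occ

/-- The constant register transition with given values. -/
def RegTransition.const {B : Type w} (R : Type) {S : Type} [Fintype S] (v : S → List B) :
    RegTransition B R S where
  toFun s := (v s).map Sum.inl
  copyless r := by simp

@[simp]
theorem RegTransition.act_const {B : Type w} {R S : Type} [Fintype S] (v : S → List B)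
    (x : R → List B) : (RegTransition.const R v).act x = v := by
  funext s
  simp [RegTransition.act_apply, RegTransition.const]

/-! ## Copyless computation of a run of a non-deterministic automaton -/

/-- `LabelledRun I E w q l`: some run on `w` with initial labels in `I` and edge labels in `E` ends
in `q` and has the label sequence `l`. -/
inductive LabelledRun {A : Type w'} {M : Type w} {Q : Type} (I : Q → Set M)
    (E : A → Q → Q → Set M) : List A → Q → List M → Prop
  | init {q : Q} {m : M} (h : m ∈ I q) : LabelledRun I E [] q [m]
  | snoc {w : List A} {q : Q} {l : List M} (h : LabelledRun I E w q l) {a : A} {r : Q} {m : M}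
      (hm : m ∈ E a q r) : LabelledRun I E (w ++ [a]) r (l ++ [m])

section Determinization

variable {A : Type w'} {M : Type w} {Q : Type} {n : ℕ} (D : Fin n → Set Q)

open Classical in
/-- The concatenation, in order, of the words attached to the members of the family `D` that
contain `q`. -/
noncomputable def branchWord (W : Fin n → List M) (q : Q) : List M :=
  ((List.finRange n).filter fun i => q ∈ D i).flatMap W

/-- The sets in the family `D` which carry a non-empty word are pairwise nested or disjoint. -/
def Laminar (W : Fin n → List M) : Prop :=
  ∀ i j, W i ≠ [] → W j ≠ [] → (D i ∩ D j).Nonempty → D i ⊆ D j ∨ D j ⊆ D i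

open Classical in
/-- The word to be added to the register `j` when each leaf `r` is extended by `ℓ r`. -/
noncomputable def leafWord (ℓ : Q → List M) (j : Fin n) : List M :=
  if h : ∃ r, D j = {r} then ℓ h.choose else []

theorem leafWord_of_eq (ℓ : Q → List M) {j : Fin n} {r : Q} (h : D j = {r}) :
    leafWord D ℓ j = ℓ r := by
  have h' : ∃ r, D j = {r} := ⟨r, h⟩
  have : h'.choose = r := Set.singleton_injective (h'.choose_spec.symm.trans h)
  rw [leafWord, dif_pos h', this]

theorem leafWord_eq_nil (ℓ : Q → List M) {j : Fin n} (h : ¬ ∃ r, D j = {r}) :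
    leafWord D ℓ j = [] := dif_neg h

theorem laminar_leafWord (ℓ : Q → List M) : Laminar D (leafWord D ℓ) := by
  intro i j hi _ ⟨q, hqi, hqj⟩
  by_cases h : ∃ r, D i = {r}
  · obtain ⟨r, h⟩ := h
    rw [h, Set.mem_singleton_iff] at hqi
    left
    rw [h, ← hqi]
    exact Set.singleton_subset_iff.2 hqj
  · exact absurd (leafWord_eq_nil D ℓ h) hi

open Classical in
/-- The words attached to the sets of the family `D` after a step that extends the run ending in
`p r` to a run ending in `r`. -/
noncomputable def stepWord (p : Q → Q) (ℓ : Q → List M) (W : Fin n → List M) (j : Fin n) :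
    List M :=
  ((List.finRange n).filter fun i => p ⁻¹' D i = D j).flatMap W ++ leafWord D ℓ j

variable {D}

/-- Among the sets containing `r`, the singleton `{r}` is the smallest, hence the last in the
enumeration, and it is the only singleton. So the new label lands at the very end of the branch. -/
theorem branchWord_leafWord_aux (hD : D.Bijective) (hle : ∀ i j, D i ⊆ D j → j ≤ i)
    (f : Fin n → List M) (ℓ : Q → List M) (r : Q) :
    branchWord D (fun j => f j ++ leafWord D ℓ j) r = branchWord D f r ++ ℓ r := by
  classical
  obtain ⟨j, hj⟩ := hD.2 {r}
  rw [branchWord, List.flatMap_append_of_last (j := j), leafWord_of_eq D ℓ hj, branchWord]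
  · exact (List.pairwise_lt_finRange n).filter _
  · simp [hj]
  · intro i hi
    apply hle
    simpa [hj] using hi
  · intro i hi hij
    refine leafWord_eq_nil D ℓ ?_
    rintro ⟨s, hs⟩
    have hr : r ∈ D i := by simpa using hi
    rw [hs, Set.mem_singleton_iff] at hr
    exact hij (hD.1 (by rw [hs, hj, hr]))

theorem branchWord_leafWord (hD : D.Bijective) (hle : ∀ i j, D i ⊆ D j → j ≤ i)
    (ℓ : Q → List M) (r : Q) : branchWord D (leafWord D ℓ) r = ℓ r := by
  have h : branchWord D (fun _ => ([] : List M)) r = [] :=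
    List.flatMap_eq_nil_iff.2 fun _ _ => rfl
  simpa [h] using branchWord_leafWord_aux hD hle (fun _ => []) ℓ r

/-- A set carrying a word after the step is a preimage of one carrying a word before, or a
singleton. Preimages that meet come from sets that meet, and taking preimages preserves inclusion.
-/
theorem Laminar.step {W : Fin n → List M} (h : Laminar D W) (p : Q → Q) (ℓ : Q → List M) :
    Laminar D (stepWord D p ℓ W) := by
  classical
  have key : ∀ j, stepWord D p ℓ W j ≠ [] →
      (∃ i, p ⁻¹' D i = D j ∧ W i ≠ []) ∨ ∃ r, D j = {r} := by
    intro j hj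
    by_contra! hcon
    refine hj ?_
    rw [stepWord, leafWord_eq_nil D ℓ (not_exists.2 hcon.2), List.append_nil,
      List.flatMap_eq_nil_iff]
    intro i hi
    exact hcon.1 i (by simpa using hi)
  rintro i j hi hj ⟨q, hqi, hqj⟩
  rcases key i hi with ⟨i', hi', hWi⟩ | ⟨r, hr⟩
  · rcases key j hj with ⟨j', hj', hWj⟩ | ⟨r, hr⟩
    · rw [← hi'] at hqi ⊢
      rw [← hj'] at hqj ⊢
      exact (h i' j' hWi hWj ⟨p q, hqi, hqj⟩).imp (fun h => Set.preimage_mono h)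
        fun h => Set.preimage_mono h
    · right
      rw [hr] at hqj ⊢
      rw [← Set.mem_singleton_iff.1 hqj]
      exact Set.singleton_subset_iff.2 hqi
  · left
    rw [hr] at hqi ⊢
    rw [← Set.mem_singleton_iff.1 hqi]
    exact Set.singleton_subset_iff.2 hqj

/-- A word moved to a set containing `r` comes from a set containing `p r`, so no segment is lost or
gained; only the order is at stake. By laminarity the sets around `p r` that carry words form a
chain, listed downwards, and preimages preserve this order. -/
theorem branchWord_stepWord (hD : D.Bijective) (hle : ∀ i j, D i ⊆ D j → j ≤ i)
    {W : Fin n → List M} (hW : Laminar D W) (p : Q → Q) (ℓ : Q → List M) (r : Q) :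
    branchWord D (stepWord D p ℓ W) r = branchWord D W (p r) ++ ℓ r := by
  classical
  choose g hg using fun i => hD.2 (p ⁻¹' D i)
  have hfib : ∀ i j, p ⁻¹' D i = D j ↔ g i = j := fun i j => by
    rw [← hg i]; exact hD.1.eq_iff
  have hmemg : ∀ i, r ∈ D (g i) ↔ p r ∈ D i := fun i => by rw [hg]; rfl
  refine (branchWord_leafWord_aux hD hle _ ℓ r).trans ?_
  congr 1
  -- Sets with empty words are discarded because laminarity says nothing about them.
  set s := (List.finRange n).filter fun i => p r ∈ D i ∧ W i ≠ [] with hs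
  set K := (List.finRange n).filter fun i => r ∈ D i with hK
  have hsW : s.flatMap W = branchWord D W (p r) := List.flatMap_filter_ne_nil _ _ _
  rw [← hsW]
  have hpw : s.Pairwise (· < ·) := (List.pairwise_lt_finRange n).filter _
  have hfiber := List.flatMap_filter_fiber g hpw
    (K := K) ((List.pairwise_lt_finRange n).filter _) ?_ ?_
  · conv_rhs => rw [← hfiber, List.flatMap_assoc]
    rw [branchWord]
    refine List.flatMap_congr fun k hk => ?_
    have hk' : r ∈ D k := by simpa [hK] using hk
    rw [← List.flatMap_filter_ne_nil, hs, List.filter_filter]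
    congr 1
    refine List.filter_congr fun i _ => ?_
    rw [← Bool.decide_and, decide_eq_decide, hfib]
    constructor
    · rintro ⟨rfl, h⟩
      exact ⟨rfl, (hmemg i).1 hk', h⟩
    · rintro ⟨h, -, h'⟩
      exact ⟨h, h'⟩
  · intro i hi j hj hij
    simp only [hs, List.mem_filter, List.mem_finRange, true_and, decide_eq_true_eq] at hi hj
    have hsub : D j ⊆ D i := by
      rcases hW i j hi.2 hj.2 ⟨p r, hi.1, hj.1⟩ with h | h
      · rw [le_antisymm hij (hle i j h)]
      · exact h
    apply hle
    rw [hg, hg]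
    exact Set.preimage_mono hsub
  · intro i hi
    simp only [hs, List.mem_filter, List.mem_finRange, true_and, decide_eq_true_eq] at hi
    simpa [hK, hmemg] using hi.1

theorem occ_map_inr_filter_finRange (P : Fin n → Prop) [DecidablePred P] (i : Fin n) :
    occ i (((List.finRange n).filter P).map (Sum.inr : Fin n → M ⊕ Fin n)) =
      if P i then 1 else 0 := by
  rw [occ_map_inr]
  split_ifs with h
  · rw [List.count_filter (by simpa using h)]
    exact List.count_eq_one_of_mem (List.nodup_finRange n) (List.mem_finRange i)
  · rw [List.count_eq_zero]
    simp [h]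

open Classical in
/-- The register transition that computes `stepWord`. -/
noncomputable def stepTransition (hD : D.Bijective) (p : Q → Q) (ℓ : Q → List M) :
    RegTransition M (Fin n) (Fin n) where
  toFun j := ((List.finRange n).filter fun i => p ⁻¹' D i = D j).map Sum.inr ++
    (leafWord D ℓ j).map Sum.inl
  copyless i := by
    -- Register `i` is used only by `k`, the index of its preimage. If this preimage is empty, the
    -- segment is retired to the register of `∅`, which no branch reads.
    obtain ⟨k, hk⟩ := hD.2 (p ⁻¹' D i)
    have h : ∀ j, p ⁻¹' D i = D j ↔ k = j := fun j => by rw [← hk]; exact hD.1.eq_iff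
    simp only [occ_append, occ_map_inr_filter_finRange, occ_map_inl, h]
    simp

theorem act_stepTransition (hD : D.Bijective) (p : Q → Q) (ℓ : Q → List M) (W : Fin n → List M) :
    (stepTransition hD p ℓ).act W = stepWord D p ℓ W := by
  funext j
  simp [RegTransition.act_apply, stepTransition, stepWord]

variable (D) in
open Classical in
/-- The register transition that outputs `branchWord D W q ++ l`. -/
noncomputable def branchTransition (q : Q) (l : List M) : RegTransition M (Fin n) Unit where
  toFun _ := ((List.finRange n).filter fun i => q ∈ D i).map Sum.inr ++ l.map Sum.inl
  copyless i := by
    simp only [occ_append, occ_map_inr_filter_finRange, occ_map_inl]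
    simp
    split_ifs <;> simp

theorem act_branchTransition (q : Q) (l : List M) (W : Fin n → List M) :
    (branchTransition D q l).act W () = branchWord D W q ++ l := by
  simp [RegTransition.act_apply, branchTransition, branchWord]

end Determinization

theorem CopylessSST.run_append_singleton {A : Type w'} {B : Type w} (T : CopylessSST A B)
    (w : List A) (a : A) : T.run (w ++ [a]) = T.step (T.run w) a := by
  simp [CopylessSST.run]

/-- A deterministic copyless transducer can output the label sequence of an accepting run of a
non-deterministic automaton, if there is any. -/
theorem exists_copylessSST_labelledRun {A : Type w'} {M : Type w} {Q : Type} [Finite Q]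
    (I : Q → Set M) (E : A → Q → Q → Set M) (O : Q → Set M) :
    ∃ (T : CopylessSST A M) (F : T.State → Prop), ∀ w,
      (F (T.run w).1 ↔ ∃ q l, LabelledRun I E w q l ∧ (O q).Nonempty) ∧
      (F (T.run w).1 → ∃ q l, LabelledRun I E w q l ∧ ∃ m ∈ O q, T.eval w = l ++ [m]) := by
  classical
  obtain ⟨n, D, hD, hle⟩ := exists_enum_set Q
  -- The predecessor depends only on the letter and the reachable set, so the machine can determine
  -- it. States with no reachable predecessor get harmless default values.
  have hpred : ∀ a (S : Set Q) r, ∃ (p : Q) (ℓ : List M),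
      (∃ q ∈ S, (E a q r).Nonempty) → p ∈ S ∧ ∃ m ∈ E a p r, ℓ = [m] := by
    intro a S r
    by_cases h : ∃ q ∈ S, (E a q r).Nonempty
    · obtain ⟨q, hq, m, hm⟩ := h
      exact ⟨q, [m], fun _ => ⟨hq, m, hm, rfl⟩⟩
    · exact ⟨r, [], fun h' => absurd h' h⟩
  choose p ℓ hp using hpred
  have hinit : ∀ q, ∃ ℓ : List M, (I q).Nonempty → ∃ m ∈ I q, ℓ = [m] := by
    intro q
    by_cases h : (I q).Nonempty
    · exact ⟨[h.some], fun _ => ⟨_, h.some_mem, rfl⟩⟩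
    · exact ⟨[], fun h' => absurd h' h⟩
  choose ℓ₀ hℓ₀ using hinit
  have hout : ∀ S : Set Q, ∃ o : RegTransition M (Fin n) Unit,
      (∃ q ∈ S, (O q).Nonempty) → ∃ q ∈ S, ∃ m ∈ O q, o = branchTransition D q [m] := by
    intro S
    by_cases h : ∃ q ∈ S, (O q).Nonempty
    · obtain ⟨q, hq, m, hm⟩ := h
      exact ⟨branchTransition D q [m], fun _ => ⟨q, hq, m, hm, rfl⟩⟩
    · exact ⟨RegTransition.const _ fun _ => [], fun h' => absurd h' h⟩
  choose o ho using hout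
  let T : CopylessSST A M :=
    { State := Set Q
      init := {q | (I q).Nonempty}
      Reg := Fin n
      trans := fun a S => ({r | ∃ q ∈ S, (E a q r).Nonempty},
        stepTransition hD (p a S) (ℓ a S))
      initReg := RegTransition.const _ (leafWord D ℓ₀)
      out := o }
  have inv : ∀ w, Laminar D (T.run w).2 ∧
      (∀ q, q ∈ (T.run w).1 ↔ ∃ l, LabelledRun I E w q l) ∧
      ∀ q ∈ (T.run w).1, LabelledRun I E w q (branchWord D (T.run w).2 q) := by
    intro w
    induction w using List.reverseRecOn with
    | nil =>
      have h1 : (T.run []).1 = {q | (I q).Nonempty} := rfl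
      have h2 : (T.run []).2 = leafWord D ℓ₀ := RegTransition.act_const _ _
      rw [h1, h2]
      refine ⟨laminar_leafWord D ℓ₀, fun q => ⟨fun ⟨m, hm⟩ => ⟨[m], .init hm⟩, ?_⟩, ?_⟩
      · rintro ⟨l, hl⟩
        generalize hw : ([] : List A) = w at hl
        cases hl with
        | init h => exact ⟨_, h⟩
        | snoc h hm => simp at hw
      · intro q hq
        rw [branchWord_leafWord hD hle]
        obtain ⟨m, hm, h⟩ := hℓ₀ q hq
        rw [h]
        exact .init hm
    | append_singleton w a ih =>
      obtain ⟨hlam, hreach, hval⟩ := ih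
      rw [T.run_append_singleton]
      generalize T.run w = c at hlam hreach hval
      have h1 : (T.step c a).1 = {r | ∃ q ∈ c.1, (E a q r).Nonempty} := rfl
      have h2 : (T.step c a).2 = stepWord D (p a c.1) (ℓ a c.1) c.2 :=
        act_stepTransition hD _ _ _
      rw [h1, h2]
      refine ⟨hlam.step _ _, fun r => ⟨?_, ?_⟩, ?_⟩
      · rintro ⟨q, hq, m, hm⟩
        exact ⟨_, (hval q hq).snoc hm⟩
      · rintro ⟨l, hl⟩
        generalize hw : w ++ [a] = w' at hl
        cases hl with
        | init h => simp at hw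
        | snoc h hm =>
          obtain ⟨rfl, h'⟩ := List.append_inj' hw rfl
          obtain rfl : a = _ := by simpa using h'
          exact ⟨_, (hreach _).2 ⟨_, h⟩, _, hm⟩
      · intro r hr
        obtain ⟨hpr, m, hm, hl⟩ := hp a c.1 r hr
        rw [branchWord_stepWord hD hle hlam, hl]
        exact (hval _ hpr).snoc hm
  refine ⟨T, fun S => ∃ q ∈ S, (O q).Nonempty, fun w => ⟨⟨?_, ?_⟩, ?_⟩⟩
  · rintro ⟨q, hq, hO⟩
    exact ⟨q, _, (inv w).2.2 q hq, hO⟩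
  · rintro ⟨q, l, hl, hO⟩
    exact ⟨q, ((inv w).2.1 q).2 ⟨l, hl⟩, hO⟩
  · intro h
    obtain ⟨q, hq, m, hm, h'⟩ := ho _ h
    refine ⟨q, _, (inv w).2.2 q hq, m, hm, ?_⟩
    have : T.eval w = (o (T.run w).1).act (T.run w).2 () := rfl
    rw [this, h', act_branchTransition]

/-! ## Normal forms of copyless register transitions -/

section NormalForm

variable {X Y : Type*} {R S : Type}

/-- The letters of a word with registers, up to the first register. -/
def headLetters : List (X ⊕ R) → List X
  | [] => []
  | Sum.inl x :: l => x :: headLetters l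
  | Sum.inr _ :: _ => []

open Classical in
/-- The letters of a word with registers that follow the first occurrence of a given register, up
to the next register. -/
noncomputable def lettersAfter : List (X ⊕ R) → R → List X
  | [] => fun _ => []
  | Sum.inl _ :: l => lettersAfter l
  | Sum.inr r :: l => Function.update (lettersAfter l) r (headLetters l)

/-- The registers of a word with registers. -/
def registers (l : List (X ⊕ R)) : List R := l.filterMap Sum.getRight?

@[simp]
theorem registers_cons_inl (x : X) (l : List (X ⊕ R)) :
    registers (Sum.inl x :: l) = registers l := rfl

@[simp]
theorem registers_cons_inr (r : R) (l : List (X ⊕ R)) :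
    registers (Sum.inr r :: l) = r :: registers l := rfl

/-- The word with given registers in which each register is followed by given letters. -/
def interleave (h : List X) (K : List R) (a : R → List X) : List (X ⊕ R) :=
  h.map Sum.inl ++ K.flatMap fun r => Sum.inr r :: (a r).map Sum.inl

theorem count_registers [DecidableEq R] (l : List (X ⊕ R)) (r : R) :
    (registers l).count r = occ r l := by
  classical
  induction l with
  | nil => simp [registers]
  | cons x l ih => rcases x with x | s <;> simp [ih, List.count_cons]

/-- Copylessness is essential: `lettersAfter` remembers only what follows the first occurrence of a
register. -/
theorem interleave_letters (l : List (X ⊕ R)) (hl : ∀ r, occ r l ≤ 1) :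
    interleave (headLetters l) (registers l) (lettersAfter l) = l := by
  classical
  induction l with
  | nil => rfl
  | cons x l ih =>
    rcases x with x | s
    · have := ih fun r => by simpa using hl r
      simpa [interleave, headLetters, lettersAfter] using this
    · have hs : s ∉ registers l := by
        have := hl s
        rw [← List.count_eq_zero, count_registers]
        simp only [occ_cons_inr, if_true] at this
        lia
      have := ih fun r => by
        have := hl r
        simp only [occ_cons_inr] at this
        lia
      simp only [interleave, headLetters, registers_cons_inr, lettersAfter, List.map_nil,
        List.nil_append, List.flatMap_cons, Function.update_self, List.cons_append,
        List.cons.injEq, true_and] at this ⊢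
      conv_rhs => rw [← this]
      congr 1
      refine List.flatMap_congr fun r hr => ?_
      rw [Function.update_of_ne]
      rintro rfl
      exact hs hr

theorem lettersAfter_of_occ_eq_zero (l : List (X ⊕ R)) {r : R} (h : occ r l = 0) :
    lettersAfter l r = [] := by
  classical
  induction l with
  | nil => rfl
  | cons x l ih =>
    rcases x with x | s
    · exact ih (by simpa using h)
    · simp only [occ_cons_inr, Nat.add_eq_zero_iff, ite_eq_right_iff, one_ne_zero, imp_false] at h
      rw [lettersAfter, Function.update_of_ne (Ne.symm h.2)]
      exact ih h.1

open Classical in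
/-- The number of occurrences of a letter in a word with registers. -/
noncomputable def letterCount (x : X) (l : List (X ⊕ R)) : ℕ :=
  l.countP fun y => y = Sum.inl x

@[simp]
theorem letterCount_nil (x : X) : letterCount x ([] : List (X ⊕ R)) = 0 := by simp [letterCount]

@[simp]
theorem letterCount_append (x : X) (l l' : List (X ⊕ R)) :
    letterCount x (l ++ l') = letterCount x l + letterCount x l' := by
  simp [letterCount]

@[simp]
theorem letterCount_cons_inr (x : X) (r : R) (l : List (X ⊕ R)) :
    letterCount x (Sum.inr r :: l) = letterCount x l := by
  simp [letterCount]

open Classical in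
@[simp]
theorem letterCount_cons_inl (x y : X) (l : List (X ⊕ R)) :
    letterCount x (Sum.inl y :: l) = letterCount x l + if y = x then 1 else 0 := by
  simp [letterCount, List.countP_cons]

@[simp]
theorem letterCount_map_inl [DecidableEq X] (x : X) (l : List X) :
    letterCount x (l.map (Sum.inl : X → X ⊕ R)) = l.count x := by
  induction l with
  | nil => simp
  | cons a l ih => simp [ih, List.count_cons]

/-- Only an inequality holds in general: when a register is repeated, the letters after its later
occurrences are overwritten. -/
theorem count_headLetters_add_sum_le [DecidableEq X] [Fintype R] (x : X) (l : List (X ⊕ R)) :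
    (headLetters l).count x + ∑ r, (lettersAfter l r).count x ≤ letterCount x l := by
  classical
  induction l with
  | nil => simp [headLetters, lettersAfter]
  | cons y l ih =>
    rcases y with y | s
    · simp only [headLetters, lettersAfter, List.count_cons, letterCount_cons_inl, beq_iff_eq]
      lia
    · simp only [headLetters, lettersAfter, letterCount_cons_inr, List.count_nil, zero_add]
      refine le_trans ?_ ih
      rw [← Finset.add_sum_erase _ _ (Finset.mem_univ s), Function.update_self]
      gcongr
      refine (Finset.sum_le_sum fun r hr => ?_).trans
        (Finset.sum_le_sum_of_subset (Finset.erase_subset s _))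
      rw [Function.update_of_ne (Finset.ne_of_mem_erase hr)]

theorem letterCount_subst {X : Type w} [Fintype S] (t : S → List (X ⊕ R)) (x : X)
    (l : List (X ⊕ S)) :
    letterCount x (RegTransition.subst t l) =
      letterCount x l + ∑ s : S, occ s l * letterCount x (t s) := by
  classical
  induction l with
  | nil => simp [RegTransition.subst]
  | cons y l ih =>
    have h : RegTransition.subst t (y :: l) =
        Sum.elim (fun c => [Sum.inl c]) t y ++ RegTransition.subst t l := by
      simp [RegTransition.subst]
    rw [h, letterCount_append, ih]
    rcases y with c | s
    · simp
      lia
    · simp [add_mul, Finset.sum_add_distrib]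
      lia

/-- Replacement of the letters of a word with registers by words. -/
def mapLetters (v : X → List Y) (l : List (X ⊕ R)) : List (Y ⊕ R) :=
  l.flatMap (Sum.elim (fun x => (v x).map Sum.inl) fun r => [Sum.inr r])

@[simp]
theorem mapLetters_append (v : X → List Y) (l l' : List (X ⊕ R)) :
    mapLetters v (l ++ l') = mapLetters v l ++ mapLetters v l' := by
  simp [mapLetters]

theorem mapLetters_cons (v : X → List Y) (x : X ⊕ R) (l : List (X ⊕ R)) :
    mapLetters v (x :: l) =
      Sum.elim (fun x => (v x).map Sum.inl) (fun r => [Sum.inr r]) x ++ mapLetters v l := by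
  simp [mapLetters]

@[simp]
theorem mapLetters_map_inl (v : X → List Y) (l : List X) :
    mapLetters v (l.map (Sum.inl : X → X ⊕ R)) = (l.flatMap v).map Sum.inl := by
  simp [mapLetters, List.flatMap_map, List.map_flatMap]

theorem mapLetters_interleave (v : X → List Y) (h : List X) (K : List R) (a : R → List X) :
    mapLetters v (interleave h K a) =
      interleave (h.flatMap v) K fun r => (a r).flatMap v := by
  simp only [interleave, mapLetters_append, mapLetters_map_inl]
  congr 1
  induction K with
  | nil => rfl
  | cons r K ih => simp [mapLetters_cons, ih]

theorem occ_mapLetters (v : X → List Y) (l : List (X ⊕ R)) (r : R) :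
    occ r (mapLetters v l) = occ r l := by
  induction l with
  | nil => rfl
  | cons x l ih => rcases x with x | s <;> simp [mapLetters_cons, ih, add_comm]

theorem mapLetters_subst {X : Type w} {Y : Type w'} (v : X → List Y) (t : S → List (X ⊕ R))
    (l : List (X ⊕ S)) :
    mapLetters v (RegTransition.subst t l) =
      RegTransition.subst (fun s => mapLetters v (t s)) (mapLetters v l) := by
  simp only [mapLetters, RegTransition.subst, List.flatMap_assoc]
  congr 1
  funext x
  rcases x with x | s
  · simp [List.flatMap_map, ← List.map_eq_flatMap]
  · simp

/-- Replacement of the letters of a register transition by words. -/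
def RegTransition.mapLetters {X : Type w} {Y : Type w'} [Fintype S] (v : X → List Y)
    (t : RegTransition X R S) : RegTransition Y R S where
  toFun s := _root_.mapLetters v (t.toFun s)
  copyless r := by simpa only [occ_mapLetters] using t.copyless r

theorem RegTransition.mapLetters_comp {T : Type} {X : Type w} {Y : Type w'} [Fintype S] [Fintype T]
    (v : X → List Y) (t : RegTransition X R S) (t' : RegTransition X S T) :
    (t.comp t').mapLetters v = (t.mapLetters v).comp (t'.mapLetters v) :=
  RegTransition.ext (funext fun _ => mapLetters_subst v _ _)

theorem RegTransition.mapLetters_id {X : Type w} {Y : Type w'} [Fintype R] (v : X → List Y) :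
    (RegTransition.id X R).mapLetters v = RegTransition.id Y R :=
  RegTransition.ext (funext fun _ => by simp [mapLetters, RegTransition.id, _root_.mapLetters])

theorem RegTransition.mapLetters_mapLetters {X : Type u} {Y : Type v} {Z : Type w} [Fintype S]
    (f : X → List Y) (g : Y → List Z) (t : RegTransition X R S) :
    (t.mapLetters f).mapLetters g = t.mapLetters fun x => (f x).flatMap g := by
  refine RegTransition.ext (funext fun s => ?_)
  simp only [mapLetters, _root_.mapLetters, List.flatMap_assoc]
  congr 1
  funext x
  rcases x with x | s
  · simp [List.flatMap_map, List.map_flatMap]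
  · simp

theorem RegTransition.mapLetters_singleton {X : Type w} [Fintype S] (t : RegTransition X R S) :
    (t.mapLetters fun x => [x]) = t := by
  refine RegTransition.ext (funext fun s => ?_)
  have h : (Sum.elim (fun x => [Sum.inl x]) fun r => [Sum.inr r]) =
      fun x : X ⊕ R => [x] := by
    funext x; rcases x with c | r <;> rfl
  simp [mapLetters, _root_.mapLetters, h]

theorem RegTransition.occ_le_one {X : Type w} [Fintype S] (t : RegTransition X R S) (r : R)
    (s : S) : occ r (t.toFun s) ≤ 1 :=
  (Finset.single_le_sum (f := fun s => occ r (t.toFun s)) (fun _ _ => Nat.zero_le _)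
    (Finset.mem_univ s)).trans (t.copyless r)

/-- Since `t'` is copyless, each word of `t` is substituted at most once, so composition duplicates
no letter. -/
theorem RegTransition.sum_letterCount_comp_le {T : Type} {X : Type w} [Fintype S] [Fintype T]
    (x : X) (t : RegTransition X R S) (t' : RegTransition X S T) :
    ∑ u, letterCount x ((t.comp t').toFun u) ≤
      ∑ s, letterCount x (t.toFun s) + ∑ u, letterCount x (t'.toFun u) := by
  simp only [RegTransition.comp, letterCount_subst, Finset.sum_add_distrib]
  rw [add_comm]
  gcongr
  rw [Finset.sum_comm]
  simp only [← Finset.sum_mul]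
  refine Finset.sum_le_sum fun s _ => ?_
  simpa using Nat.mul_le_mul_right _ (t'.copyless s)

end NormalForm

/-! ### Decomposition of a register transition into skeleton and letters -/

section Skeleton

variable {X : Type w} {R : Type} [Fintype R]

open Classical in
/-- The possible arrangements of the registers in a copyless register transition from `R` to
itself. -/
abbrev Skeleton (R : Type) [Fintype R] := {K : R → List R // ∀ r, ∑ s, (K s).count r ≤ 1}

instance : Finite (Skeleton R) := by
  classical
  have : Finite {l : List R // l.length ≤ Fintype.card R} :=
    List.finite_length_le R (Fintype.card R)
  refine Finite.of_injective (β := R → {l : List R // l.length ≤ Fintype.card R})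
    (fun K s => ⟨K.1 s, ?_⟩) ?_
  -- Copylessness makes each word of registers duplicate-free, which bounds its length.
  · refine List.Nodup.length_le_card (List.nodup_iff_count_le_one.2 fun r => ?_)
    exact (Finset.single_le_sum (f := fun s => (K.1 s).count r) (fun _ _ => Nat.zero_le _)
      (Finset.mem_univ s)).trans (by convert K.2 r)
  · intro K K' h
    refine Subtype.ext (funext fun s => ?_)
    simpa using congrFun h s

/-- The arrangement of the registers in a register transition. -/
def RegTransition.skeleton (t : RegTransition X R R) : Skeleton R :=
  ⟨fun s => registers (t.toFun s), fun r => by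
    classical
    convert t.copyless r using 2 with s
    convert count_registers (t.toFun s) r⟩

/-- The words of letters in a register transition: those in front of the first register of the
image of a register, and those following the occurrence of a register. -/
noncomputable def RegTransition.letters (t : RegTransition X R R) : R ⊕ R → List X
  | Sum.inl s => headLetters (t.toFun s)
  | Sum.inr r => Finset.univ.toList.flatMap fun s => lettersAfter (t.toFun s) r

/-- The register transition with a given skeleton and given letters. -/
def Skeleton.fill (K : Skeleton R) (h : R ⊕ R → List X) : RegTransition X R R where
  toFun s := interleave (h (Sum.inl s)) (K.1 s) fun r => h (Sum.inr r)
  copyless r := by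
    classical
    have key : ∀ K : List R, occ r (K.flatMap fun r => (Sum.inr r : X ⊕ R) ::
        (h (Sum.inr r)).map Sum.inl) = K.count r := by
      intro K
      induction K with
      | nil => simp
      | cons a K ih => simp [ih, List.count_cons, add_comm]
    simp only [interleave, occ_append, occ_map_inl, key, zero_add]
    convert K.2 r

/-- A register occurs in at most one of the words, so the concatenation defining
`RegTransition.letters` at it has at most one non-empty term. -/
theorem RegTransition.fill_skeleton_letters (t : RegTransition X R R) :
    t.skeleton.fill t.letters = t := by
  classical
  refine RegTransition.ext (funext fun s => ?_)
  conv_rhs => rw [← interleave_letters (t.toFun s) fun r => t.occ_le_one r s]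
  simp only [Skeleton.fill, skeleton, letters, interleave]
  congr 1
  refine List.flatMap_congr fun r hr => ?_
  congr 2
  have hs : occ r (t.toFun s) ≠ 0 := by
    rw [← count_registers]
    exact (List.count_pos_iff.2 hr).ne'
  have hother : ∀ s', s' ≠ s → lettersAfter (t.toFun s') r = [] := by
    intro s' hs'
    apply lettersAfter_of_occ_eq_zero
    have h1 := t.copyless r
    rw [← Finset.add_sum_erase _ _ (Finset.mem_univ s)] at h1
    have h2 := Finset.single_le_sum (f := fun s => occ r (t.toFun s)) (fun _ _ => Nat.zero_le _)
      (Finset.mem_erase.2 ⟨hs', Finset.mem_univ s'⟩)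
    lia
  have key : ∀ L : List R, L.Nodup → s ∈ L →
      (L.flatMap fun s => lettersAfter (t.toFun s) r) = lettersAfter (t.toFun s) r := by
    intro L hL hsL
    induction L with
    | nil => simp at hsL
    | cons a L ih =>
      rw [List.nodup_cons] at hL
      by_cases ha : a = s
      · subst ha
        have : (L.flatMap fun s => lettersAfter (t.toFun s) r) = [] :=
          List.flatMap_eq_nil_iff.2 fun s' hs' => hother s' fun h => hL.1 (h ▸ hs')
        simp [this]
      · have hs' := (List.mem_cons.1 hsL).resolve_left (Ne.symm ha)
        simp [hother a ha, ih hL.2 hs']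
  exact key _ (Finset.nodup_toList _) (by simp)

theorem Skeleton.mapLetters_fill {Y : Type w'} (K : Skeleton R) (h : R ⊕ R → List X)
    (v : X → List Y) : (K.fill h).mapLetters v = K.fill fun z => (h z).flatMap v :=
  RegTransition.ext (funext fun _ => mapLetters_interleave _ _ _ _)

theorem RegTransition.sum_count_letters_le [DecidableEq X] (t : RegTransition X R R) (x : X) :
    ∑ z, (t.letters z).count x ≤ ∑ s, letterCount x (t.toFun s) := by
  have h : ∀ r, (t.letters (Sum.inr r)).count x = ∑ s, (lettersAfter (t.toFun s) r).count x := by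
    intro r
    simp [letters, List.count_flatMap, Function.comp_def]
  rw [Fintype.sum_sum_type]
  simp only [h]
  rw [Finset.sum_comm, ← Finset.sum_add_distrib]
  exact Finset.sum_le_sum fun s _ => count_headLetters_add_sum_le x _

theorem Skeleton.sum_letterCount_fill [DecidableEq X] (K : Skeleton R) (h : R ⊕ R → List X)
    (x : X) : ∑ s, letterCount x ((K.fill h).toFun s) ≤ ∑ z, (h z).count x := by
  classical
  have key : ∀ K : List R, letterCount x (K.flatMap fun r => (Sum.inr r : X ⊕ R) ::
      (h (Sum.inr r)).map Sum.inl) = ∑ r, K.count r * (h (Sum.inr r)).count x := by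
    intro K
    induction K with
    | nil => simp
    | cons a K ih =>
      simp [ih, List.count_cons, add_mul, Finset.sum_add_distrib, add_comm]
  simp only [fill, interleave, letterCount_append, letterCount_map_inl, key,
    Finset.sum_add_distrib, Fintype.sum_sum_type]
  refine Nat.add_le_add_left ?_ _
  rw [Finset.sum_comm]
  simp only [← Finset.sum_mul]
  refine Finset.sum_le_sum fun r _ => ?_
  have hK : ∑ s, (K.1 s).count r ≤ 1 := by convert K.2 r
  simpa using Nat.mul_le_mul_right _ hK

end Skeleton

/-! ## Evaluation of words of copyless register transitions by copyless transducers -/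

theorem RegTransition.act_comp {B : Type w} {R S T : Type} [Fintype S] [Fintype T]
    (t : RegTransition B R S) (t' : RegTransition B S T) (x : R → List B) :
    (t.comp t').act x = t'.act (t.act x) :=
  funext fun _ => actWord_subst _ _ _

theorem RegTransition.id_comp {B : Type w} {R S : Type} [Fintype R] [Fintype S]
    (t : RegTransition B R S) : (RegTransition.id B R).comp t = t :=
  @Category.id_comp (RegSet B) _ ⟨R⟩ ⟨S⟩ t

theorem RegTransition.comp_id {B : Type w} {R S : Type} [Fintype R] [Fintype S]
    (t : RegTransition B R S) : t.comp (RegTransition.id B S) = t :=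
  @Category.comp_id (RegSet B) _ ⟨R⟩ ⟨S⟩ t

theorem RegTransition.comp_assoc {B : Type w} {R S T U : Type} [Fintype R] [Fintype S] [Fintype T]
    [Fintype U] (t : RegTransition B R S) (t' : RegTransition B S T) (t'' : RegTransition B T U) :
    (t.comp t').comp t'' = t.comp (t'.comp t'') :=
  @Category.assoc (RegSet B) _ ⟨R⟩ ⟨S⟩ ⟨T⟩ ⟨U⟩ t t' t''

theorem letterCount_inr_mapLetters_inl {B : Type w} {P R : Type} (p : P) (l : List (B ⊕ R)) :
    letterCount (Sum.inr p : B ⊕ P) (mapLetters (fun b => [Sum.inl b]) l) = 0 := by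
  induction l with
  | nil => simp [mapLetters]
  | cons x l ih => rcases x with b | r <;> simp [mapLetters_cons, ih]

section Evaluation

variable {B : Type w} {R Y : Type} [Fintype R]

/-- The composite of a list of register transitions. -/
def RegTransition.prod (l : List (RegTransition B R R)) : RegTransition B R R :=
  l.foldr RegTransition.comp (RegTransition.id B R)

@[simp]
theorem RegTransition.prod_nil : prod ([] : List (RegTransition B R R)) = RegTransition.id B R :=
  rfl

@[simp]
theorem RegTransition.prod_cons (t : RegTransition B R R) (l : List (RegTransition B R R)) :
    prod (t :: l) = t.comp (prod l) := rfl

theorem RegTransition.prod_append (l l' : List (RegTransition B R R)) :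
    prod (l ++ l') = (prod l).comp (prod l') := by
  induction l with
  | nil => exact (id_comp _).symm
  | cons t l ih =>
    rw [List.cons_append, prod_cons, ih, prod_cons, comp_assoc]

/-- The symbolic value of a register transition, or of a register `y` containing a word of register
transitions whose composite has the skeleton `K y`. -/
def symbolicItem (K : Y → Skeleton R) :
    RegTransition B R R ⊕ Y → RegTransition (B ⊕ Y × (R ⊕ R)) R R
  | Sum.inl t => t.mapLetters fun b => [Sum.inl b]
  | Sum.inr y => (K y).fill fun z => [Sum.inr (y, z)]

/-- The symbolic value of a word of register transitions and of registers containing such words. -/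
def symbolicValue (K : Y → Skeleton R) (l : List (RegTransition B R R ⊕ Y)) :
    RegTransition (B ⊕ Y × (R ⊕ R)) R R :=
  RegTransition.prod (l.map (symbolicItem K))

/-- This is what makes the symbolic updates copyless: the placeholder `(y, z)` enters at most once
per occurrence of `y`, and composition never duplicates it. -/
theorem sum_letterCount_symbolicValue (K : Y → Skeleton R) (l : List (RegTransition B R R ⊕ Y))
    (y : Y) (z : R ⊕ R) :
    ∑ s, letterCount (Sum.inr (y, z)) ((symbolicValue K l).toFun s) ≤ occ y l := by
  classical
  induction l with
  | nil => simp [symbolicValue, RegTransition.id]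
  | cons x l ih =>
    refine (RegTransition.sum_letterCount_comp_le _ _ _).trans ?_
    rcases x with t | y'
    · rw [occ_cons_inl]
      refine le_of_eq_of_le ?_ ih
      simp [symbolicItem, RegTransition.mapLetters, letterCount_inr_mapLetters_inl, symbolicValue,
        RegTransition.prod]
    · rw [occ_cons_inr, add_comm]
      have h := Skeleton.sum_letterCount_fill (K y') (fun z => [Sum.inr (y', z)])
        (Sum.inr (y, z) : B ⊕ Y × (R ⊕ R))
      refine add_le_add ih (h.trans ?_)
      simp only [List.count_singleton, beq_iff_eq, Sum.inr.injEq, Prod.mk.injEq]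
      split_ifs with h <;> simp [h]

/-- Replacing letters is compatible with composition, so placeholders may be filled with actual
contents before or after composing. -/
theorem mapLetters_symbolicValue (K : Y → Skeleton R) (V : Y → List (RegTransition B R R))
    (W : Y × (R ⊕ R) → List B) (h : ∀ y, RegTransition.prod (V y) = (K y).fill fun z => W (y, z))
    (l : List (RegTransition B R R ⊕ Y)) :
    (symbolicValue K l).mapLetters (Sum.elim (fun b => [b]) W) =
      RegTransition.prod (actWord V l) := by
  induction l with
  | nil => exact RegTransition.mapLetters_id _
  | cons x l ih =>
    have h1 : actWord V (x :: l) = Sum.elim (fun t => [t]) V x ++ actWord V l := by simp [actWord]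
    refine (RegTransition.mapLetters_comp _ _ _).trans ?_
    rw [h1, RegTransition.prod_append]
    refine congrArg₂ _ ?_ ih
    rcases x with t | y
    · simp [symbolicItem, RegTransition.mapLetters_mapLetters, RegTransition.mapLetters_singleton,
        RegTransition.comp_id]
    · simp [symbolicItem, Skeleton.mapLetters_fill, h]

theorem RegTransition.sum_countP_letters_le {X : Type w} (t : RegTransition X R R) (x : X)
    (p : X → Bool) (hp : ∀ y, p y = true ↔ y = x) :
    ∑ z, (t.letters z).countP p ≤ ∑ s, letterCount x (t.toFun s) := by
  classical
  refine le_of_eq_of_le (Finset.sum_congr rfl fun z _ => ?_) (t.sum_count_letters_le x)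
  exact List.countP_congr fun y _ => (hp y).trans beq_iff_eq.symm

/-- The letters of the symbolic values of the images of a register transition. -/
noncomputable def symbolicTransition {S : Type} [Fintype S] (K : Y → Skeleton R)
    (t : RegTransition (RegTransition B R R) Y S) :
    RegTransition B (Y × (R ⊕ R)) (S × (R ⊕ R)) where
  toFun p := (symbolicValue K (t.toFun p.1)).letters p.2
  copyless := fun (y, z) => by
    rw [Fintype.sum_prod_type]
    exact (Finset.sum_le_sum fun s _ => (RegTransition.sum_countP_letters_le _ (Sum.inr (y, z)) _
      fun _ => by simp).trans
      (sum_letterCount_symbolicValue _ _ _ _)).trans (t.copyless y)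

theorem fill_act_symbolicTransition {S : Type} [Fintype S] (K : Y → Skeleton R)
    (t : RegTransition (RegTransition B R R) Y S) (V : Y → List (RegTransition B R R))
    (W : Y × (R ⊕ R) → List B) (h : ∀ y, RegTransition.prod (V y) = (K y).fill fun z => W (y, z))
    (s : S) :
    (symbolicValue K (t.toFun s)).skeleton.fill
      (fun z => (symbolicTransition K t).act W (s, z)) = RegTransition.prod (t.act V s) := by
  rw [RegTransition.act_apply, ← mapLetters_symbolicValue K V W h]
  conv_rhs => rw [← RegTransition.fill_skeleton_letters (symbolicValue K (t.toFun s))]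
  rw [Skeleton.mapLetters_fill]
  rfl

/-- The letters of the symbolic value of the output, in the image of the register `r`. -/
noncomputable def symbolicOutput (K : Y → Skeleton R)
    (t : RegTransition (RegTransition B R R) Y Unit) (r : R) :
    RegTransition B (Y × (R ⊕ R)) Unit where
  -- Register symbols are erased because the evaluation starts from empty registers.
  toFun _ := ((symbolicValue K (t.toFun ())).toFun r).filterMap Sum.getLeft?
  copyless := fun (y, z) => by
    classical
    have h : ∀ l : List ((B ⊕ Y × (R ⊕ R)) ⊕ R),
        occ (y, z) (l.filterMap Sum.getLeft?) = letterCount (Sum.inr (y, z)) l := by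
      intro l
      induction l with
      | nil => simp
      | cons x l ih => rcases x with (b | p) | s <;> simp [ih, List.filterMap_cons]
    simp only [h, Finset.univ_unique, Finset.sum_singleton]
    refine le_trans ?_ ((sum_letterCount_symbolicValue K (t.toFun ()) y z).trans
      (t.occ_le_one y ()))
    exact Finset.single_le_sum
      (f := fun s => letterCount (Sum.inr (y, z)) ((symbolicValue K (t.toFun ())).toFun s))
      (fun _ _ => Nat.zero_le _) (Finset.mem_univ r)

theorem act_symbolicOutput (K : Y → Skeleton R) (t : RegTransition (RegTransition B R R) Y Unit)
    (r : R) (V : Y → List (RegTransition B R R)) (W : Y × (R ⊕ R) → List B)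
    (h : ∀ y, RegTransition.prod (V y) = (K y).fill fun z => W (y, z)) :
    (symbolicOutput K t r).act W () = (RegTransition.prod (t.act V ())).act (fun _ => []) r := by
  rw [RegTransition.act_apply t, ← mapLetters_symbolicValue K V W h]
  simp only [RegTransition.act_apply, symbolicOutput, RegTransition.mapLetters]
  generalize (symbolicValue K (t.toFun ())).toFun r = l
  induction l with
  | nil => rfl
  | cons x l ih =>
    rcases x with (b | p) | s <;>
      simp_all [mapLetters_cons, List.filterMap_cons, actWord, List.flatMap_map]

end Evaluation

/-- A copyless transducer whose outputs are words of copyless register transitions can be turned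
into a copyless transducer that evaluates these words and outputs the contents of a register. -/
theorem CopylessSST.exists_eval_eq_act_prod {A : Type w'} {B : Type w} {R : Type} [Fintype R]
    (T : CopylessSST A (RegTransition B R R)) (r : R) :
    ∃ (T' : CopylessSST A B) (f : T'.State → T.State), ∀ w,
      f (T'.run w).1 = (T.run w).1 ∧
      T'.eval w = (RegTransition.prod (T.eval w)).act (fun _ => []) r := by
  let m₀ : T.Reg → RegTransition B R R := fun y =>
    RegTransition.prod (T.initReg.act Empty.elim y)
  let T' : CopylessSST A B :=
    { State := T.State × (T.Reg → Skeleton R)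
      init := (T.init, fun y => (m₀ y).skeleton)
      Reg := T.Reg × (R ⊕ R)
      trans := fun a s =>
        (((T.trans a s.1).1, fun y =>
          (symbolicValue s.2 ((T.trans a s.1).2.toFun y)).skeleton),
        symbolicTransition s.2 (T.trans a s.1).2)
      initReg := RegTransition.const _ fun p => (m₀ p.1).letters p.2
      out := fun s => symbolicOutput s.2 (T.out s.1) r }
  -- Skeleton in the state and letters in the registers together encode the composite of the word
  -- held in register `y`.
  have inv : ∀ w, (T'.run w).1.1 = (T.run w).1 ∧ ∀ y,
      RegTransition.prod ((T.run w).2 y) =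
        ((T'.run w).1.2 y).fill fun z => (T'.run w).2 (y, z) := by
    intro w
    induction w using List.reverseRecOn with
    | nil =>
      refine ⟨rfl, fun y => ?_⟩
      have h : (T'.run []).2 = fun p => (m₀ p.1).letters p.2 := RegTransition.act_const _ _
      rw [h]
      exact (RegTransition.fill_skeleton_letters (m₀ y)).symm
    | append_singleton w a ih =>
      rw [T.run_append_singleton, T'.run_append_singleton]
      generalize T.run w = c at ih
      generalize T'.run w = c' at ih
      obtain ⟨s, V⟩ := c
      obtain ⟨⟨s', K⟩, W⟩ := c'
      obtain ⟨rfl, h⟩ := ih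
      exact ⟨rfl, fun y => (fill_act_symbolicTransition K _ V W h y).symm⟩
  refine ⟨T', Prod.fst, fun w => ⟨(inv w).1, ?_⟩⟩
  refine (act_symbolicOutput _ _ r (T.run w).2 _ (inv w).2).trans ?_
  rw [(inv w).1]
  rfl

/-! ## From non-deterministic to deterministic transducers -/

/-! ### Simulation of varying register sets in one fixed set -/

section Embed

variable {B : Type w} {R S P : Type} [Fintype S] [Fintype P]

open Classical in
/-- A register transition from `R` to `S`, seen as a transition of a set of registers that contains
both `R` and `S`. -/
noncomputable def RegTransition.embed (f : RegTransition B R S) {i : R → P} (hi : i.Injective)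
    {j : S → P} (hj : j.Injective) : RegTransition B P P where
  toFun p := if h : ∃ s, j s = p then (f.toFun h.choose).map (Sum.map _root_.id i) else []
  copyless p := by
    have h1 : ∀ p, (∀ s, j s ≠ p) → (if h : ∃ s, j s = p then
        (f.toFun h.choose).map (Sum.map _root_.id i) else []) = [] := fun p hp =>
      dif_neg fun ⟨s, hs⟩ => hp s hs
    have h2 : ∀ s, (if h : ∃ s', j s' = j s then
        (f.toFun h.choose).map (Sum.map _root_.id i) else []) =
          (f.toFun s).map (Sum.map _root_.id i) := by
      intro s
      have h : ∃ s', j s' = j s := ⟨s, rfl⟩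
      rw [dif_pos h, hj h.choose_spec]
    rw [← Finset.sum_subset (Finset.subset_univ (Finset.univ.map ⟨j, hj⟩)), Finset.sum_map]
    · simp only [Function.Embedding.coeFn_mk, h2]
      by_cases hp : ∃ r, i r = p
      · obtain ⟨r, rfl⟩ := hp
        refine le_of_eq_of_le (Finset.sum_congr rfl fun s _ => ?_) (f.copyless r)
        generalize f.toFun s = l
        induction l with
        | nil => simp
        | cons x l ih => rcases x with x | r' <;> simp [ih, hi.eq_iff]
      · have : ∀ l : List (B ⊕ R), occ p (l.map (Sum.map _root_.id i)) = 0 := by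
          intro l
          induction l with
          | nil => simp
          | cons x l ih =>
            rcases x with x | r'
            · simp [ih]
            · simpa [ih] using fun h => hp ⟨r', h⟩
        simp [this]
    · intro p' _ hp'
      rw [h1 p' fun s hs => hp' (by simp [← hs]), occ_nil]

theorem RegTransition.act_embed (f : RegTransition B R S) {i : R → P} (hi : i.Injective)
    {j : S → P} (hj : j.Injective) (x : P → List B) (s : S) :
    (f.embed hi hj).act x (j s) = f.act (x ∘ i) s := by
  have h : ∃ s', j s' = j s := ⟨s, rfl⟩
  have h' : h.choose = s := hj h.choose_spec
  simp only [act_apply, embed, dif_pos h, h']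
  simp only [actWord, List.flatMap_map]
  congr 1
  funext y
  rcases y with y | y <;> rfl

end Embed

theorem NondetSdmSST.run_append_singleton {X : Type w} {𝔠 : StreamingSetting.{u, v, w} X}
    {A : Type w'} (N : NondetSdmSST 𝔠 A) (w : List A) (a : A) :
    N.run (w ++ [a]) = N.step (N.run w) a := by
  simp [NondetSdmSST.run]

/-- The registers of an object of `SR B`. -/
abbrev SR.regs {B : Type w} (R : (SR B).Obj) : Type := RegSet.regs (B := B) R

instance {B : Type w} (R : (SR B).Obj) : Fintype (SR.regs R) := RegSet.fintype_regs (B := B) R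

theorem SR_interp_comp {B : Type w} {R : (SR B).Obj} (t : RegTransition B Empty (SR.regs R))
    (t' : RegTransition B (SR.regs R) Unit) :
    (SR B).interp (t.comp t') = t'.act (t.act Empty.elim) () := by
  rw [← RegTransition.act_comp]
  change ((t.comp t').toFun ()).map _ = ((t.comp t').toFun ()).flatMap _
  rw [List.map_eq_flatMap]
  congr 1
  funext x
  rcases x with x | x
  · rfl
  · exact x.elim

/-- Every non-deterministic transducer with copyless register updates is uniformized by a
deterministic copyless transducer, whose domain is determined by the last state. -/
theorem NondetSdmSST.exists_copylessSST {A : Type w'} {B : Type w} (N : NondetSdmSST (SR B) A) :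
    ∃ (T : CopylessSST A B) (F : T.State → Prop), ∀ w,
      (F (T.run w).1 ↔ (N.eval w).Nonempty) ∧ (F (T.run w).1 → T.eval w ∈ N.eval w) := by
  classical
  have := Fintype.ofFinite N.State
  -- The disjoint union of all register sets, with the extra register `none` receiving the output.
  let P := Option (Σ q, SR.regs (N.mem q))
  let j : (q : N.State) → SR.regs (N.mem q) → P := fun q r => some ⟨q, r⟩
  have hj : ∀ q, (j q).Injective := fun q => (Option.some_injective _).comp sigma_mk_injective
  have he : (Empty.elim : Empty → P).Injective := fun x => x.elim
  have hu : (fun _ => none : Unit → P).Injective := fun _ _ _ => rfl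
  let I : N.State → Set (RegTransition B P P) := fun q =>
    {m | ∃ h : q ∈ N.init, m = RegTransition.embed (S := SR.regs (N.mem q)) (N.initMor ⟨q, h⟩) he (hj q)}
  let E : A → N.State → N.State → Set (RegTransition B P P) := fun a q r =>
    {m | ∃ g : N.mem q ⟶ N.mem r, (a, ⟨(q, r), g⟩) ∈ N.trans ∧
      m = RegTransition.embed (S := SR.regs (N.mem r)) g (hj q) (hj r)}
  let O : N.State → Set (RegTransition B P P) := fun q =>
    {m | ∃ g, N.outMor q = some g ∧ m = RegTransition.embed (S := Unit) g (hj q) hu}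
  -- Executing the labels on `P` reproduces the register contents of an actual configuration; only
  -- the registers belonging to the current state matter.
  have hsound : ∀ w q l, LabelledRun I E w q l → ∃ c : RegTransition B Empty (SR.regs (N.mem q)),
      ⟨q, c⟩ ∈ N.run w ∧
        ∀ r, (RegTransition.prod l).act (fun _ => []) (j q r) = c.act Empty.elim r := by
    intro w q l h
    induction h with
    | @init q m h =>
      obtain ⟨h, rfl⟩ := h
      refine ⟨N.initMor ⟨q, h⟩, ⟨⟨q, h⟩, rfl⟩, fun r => ?_⟩
      rw [RegTransition.prod_cons, RegTransition.prod_nil, RegTransition.comp_id]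
      refine (RegTransition.act_embed (S := SR.regs (N.mem q)) (N.initMor ⟨q, h⟩) he (hj q)
        _ r).trans ?_
      congr 1
      exact Subsingleton.elim (α := Empty → List B) _ _
    | @snoc w q l _ a r m hm ih =>
      obtain ⟨c, hc, hval⟩ := ih
      obtain ⟨g, hg, rfl⟩ := hm
      refine ⟨RegTransition.comp (T := SR.regs (N.mem r)) c g, ?_, fun s => ?_⟩
      · rw [N.run_append_singleton]
        exact ⟨⟨q, c⟩, hc, g, hg, rfl⟩
      · rw [RegTransition.prod_append, RegTransition.prod_cons, RegTransition.prod_nil,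
          RegTransition.comp_id, RegTransition.act_comp]
        refine (RegTransition.act_embed (R := SR.regs (N.mem q)) (S := SR.regs (N.mem r)) g (hj q)
          (hj r) _ s).trans ?_
        refine Eq.trans ?_ (congrFun (RegTransition.act_comp (S := SR.regs (N.mem q))
          (T := SR.regs (N.mem r)) c g Empty.elim) s).symm
        congr 1
        exact funext hval
  have hcomplete : ∀ w, ∀ c ∈ N.run w, ∃ l, LabelledRun I E w c.1 l := by
    intro w
    induction w using List.reverseRecOn with
    | nil =>
      rintro _ ⟨⟨q, h⟩, rfl⟩
      exact ⟨_, .init ⟨h, rfl⟩⟩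
    | append_singleton w a ih =>
      rw [N.run_append_singleton]
      rintro c' ⟨c, hc, g, hg, -⟩
      obtain ⟨l, hl⟩ := ih c hc
      exact ⟨_, hl.snoc ⟨g, hg, rfl⟩⟩
  obtain ⟨T, F, hT⟩ := exists_copylessSST_labelledRun I E O
  obtain ⟨T', f, hT'⟩ := T.exists_eval_eq_act_prod (none : P)
  refine ⟨T', F ∘ f, fun w => ⟨?_, fun h => ?_⟩⟩
  · rw [Function.comp, (hT' w).1, (hT w).1]
    constructor
    · rintro ⟨q, l, hl, m, g, hg, -⟩
      obtain ⟨c, hc, -⟩ := hsound w q l hl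
      exact ⟨_, _, hc, g, hg, rfl⟩
    · rintro ⟨x, c, hc, g, hg, -⟩
      obtain ⟨l, hl⟩ := hcomplete w c hc
      exact ⟨_, l, hl, _, g, hg, rfl⟩
  · rw [Function.comp, (hT' w).1] at h
    obtain ⟨q, l, hl, m, ⟨g, hg, rfl⟩, hm⟩ := (hT w).2 h
    obtain ⟨c, hc, hval⟩ := hsound w q l hl
    refine ⟨_, hc, g, hg, ?_⟩
    rw [(hT' w).2, hm, RegTransition.prod_append, RegTransition.prod_cons, RegTransition.prod_nil,
      RegTransition.comp_id, RegTransition.act_comp]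
    refine (RegTransition.act_embed (B := B) (R := SR.regs (N.mem q)) g (hj q) hu _ ()).trans ?_
    refine Eq.trans ?_ (SR_interp_comp (R := N.mem q) c g).symm
    congr 1
    exact funext hval

/-! ### Copyless transducers as machines over `SR B` -/

namespace CopylessSST

variable {A : Type w'} {B : Type w} (T : CopylessSST A B)

/-- A copyless transducer as a transducer over the streaming setting of registers. -/
def toSdmSST : SdmSST (SR B) A where
  State := T.State
  init := T.init
  mem _ := (⟨T.Reg⟩ : RegSet B)
  trans a q := ⟨(T.trans a q).1, (T.trans a q).2⟩
  initMor := T.initReg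
  outMor := T.out

open Classical in
/-- A copyless transducer as a partial transducer over the streaming setting of registers, the
output being defined in the states that satisfy `F`. -/
noncomputable def toPartialSdmSST (F : T.State → Prop) : PartialSdmSST (SR B) A where
  State := T.State
  init := T.init
  mem _ := (⟨T.Reg⟩ : RegSet B)
  trans a q := ⟨(T.trans a q).1, (T.trans a q).2⟩
  initMor := T.initReg
  outMor q := if F q then some (T.out q) else none

theorem run_eq_of_run_toSdmSST (w : List A) :
    T.run w = ((T.toSdmSST.run w).1,
      RegTransition.act (B := B) (S := T.Reg) (T.toSdmSST.run w).2 Empty.elim) := by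
  induction w using List.reverseRecOn with
  | nil => rfl
  | append_singleton w a ih =>
    have h : T.toSdmSST.run (w ++ [a]) = T.toSdmSST.step (T.toSdmSST.run w) a := by
      simp [SdmSST.run]
    rw [T.run_append_singleton, h, ih]
    exact Prod.ext rfl
      (RegTransition.act_comp (B := B) (S := T.Reg) (T := T.Reg) _ _ Empty.elim).symm

theorem eval_toSdmSST : T.toSdmSST.eval = T.eval := by
  funext w
  rw [CopylessSST.eval, T.run_eq_of_run_toSdmSST]
  exact SR_interp_comp (R := (⟨T.Reg⟩ : RegSet B)) _ _

open Classical in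
theorem eval_toPartialSdmSST (F : T.State → Prop) (w : List A) :
    (T.toPartialSdmSST F).eval w = if F (T.run w).1 then some (T.eval w) else none := by
  rw [← T.eval_toSdmSST, T.run_eq_of_run_toSdmSST]
  change Option.map _ (if F (T.toSdmSST.run w).1 then some _ else none) = _
  split_ifs <;> rfl

end CopylessSST

/-! ## Elimination of products -/

namespace SdmSST

variable {X : Type w} {𝔠 : StreamingSetting.{u, v, w} X} {A : Type w'} [Finite A]
  (T : SdmSST 𝔠.withProd A)

/-- The index set of the memory at a state. -/
abbrev MemIdx (q : T.State) : Type := FreeProd.Idx (C := 𝔠.Obj) (T.mem q)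

instance (q : T.State) : Finite (T.MemIdx q) := FreeProd.finite_idx (C := 𝔠.Obj) (T.mem q)

/-- The components of the memory at a state. -/
abbrev memObj (s : Σ q, T.MemIdx q) : 𝔠.Obj := FreeProd.obj (C := 𝔠.Obj) (T.mem s.1) s.2

/-- The initial morphism of a component. -/
def initComponent : (s : Σ q, T.MemIdx q) → s.1 = T.init → (𝔠.start ⟶ T.memObj s)
  | ⟨_, y⟩, rfl => (T.initMor y).2

/-- The non-deterministic transducer that guesses the component of the memory which contributes to
the output. -/
noncomputable def toNondet : NondetSdmSST 𝔠 A where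
  State := Σ q, T.MemIdx q
  init := {s | s.1 = T.init}
  mem := T.memObj
  -- Transitions are indexed by the target component, which determines the source component;
  -- finiteness of `A` makes them finite in number.
  trans := Set.range fun t : Σ (a : A) (q : T.State), T.MemIdx (T.trans a q).1 =>
    (t.1, ⟨(⟨t.2.1, ((T.trans t.1 t.2.1).2 t.2.2).1⟩, ⟨_, t.2.2⟩),
      ((T.trans t.1 t.2.1).2 t.2.2).2⟩)
  finite_trans := Set.finite_range _
  initMor s := T.initComponent s s.2
  outMor s := by
    classical
    exact if h : ∃ g : T.memObj s ⟶ 𝔠.final, T.outMor s.1 () = ⟨s.2, g⟩ then some h.choose else none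

/-- The components of a configuration. -/
def component (c : T.Config) (y : T.MemIdx c.1) : T.toNondet.Config :=
  ⟨⟨c.1, y⟩, (c.2 y).2⟩

theorem outMor_toNondet_eq_some_iff (s : Σ q, T.MemIdx q) (g : T.memObj s ⟶ 𝔠.final) :
    T.toNondet.outMor s = some g ↔ T.outMor s.1 () = ⟨s.2, g⟩ := by
  classical
  change (if h : ∃ g : T.memObj s ⟶ 𝔠.final, T.outMor s.1 () = ⟨s.2, g⟩ then some h.choose
    else none) = some g ↔ _
  split_ifs with h
  · have h' := h.choose_spec
    rw [Option.some_inj]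
    constructor
    · rintro rfl
      exact h'
    · intro h''
      exact eq_of_heq (Sigma.mk.inj (h'.symm.trans h'')).2
  · exact ⟨fun h' => by simp at h', fun h' => absurd ⟨g, h'⟩ h⟩

/-- Each component after the step has exactly one source component before it, so the reachable
configurations are the components of the deterministic configuration and nothing else. -/
theorem step_toNondet (c : T.Config) (a : A) :
    T.toNondet.step (Set.range (T.component c)) a = Set.range (T.component (T.step c a)) := by
  obtain ⟨q, v⟩ := c
  ext ⟨s, v'⟩
  constructor
  · rintro ⟨_, ⟨y, rfl⟩, g, ⟨⟨a', q', y'⟩, h⟩, hv⟩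
    dsimp only [component] at h
    cases h
    exact ⟨y', congrArg (Sigma.mk _) hv.symm⟩
  · rintro ⟨y, h⟩
    cases h
    exact ⟨_, ⟨_, rfl⟩, _, ⟨⟨a, q, y⟩, rfl⟩, rfl⟩

theorem run_toNondet (w : List A) : T.toNondet.run w = Set.range (T.component (T.run w)) := by
  induction w using List.reverseRecOn with
  | nil =>
    ext c
    constructor
    · rintro ⟨⟨⟨q, y⟩, h⟩, rfl⟩
      obtain rfl : q = T.init := h
      exact ⟨y, rfl⟩
    · rintro ⟨y, rfl⟩
      exact ⟨⟨⟨_, y⟩, rfl⟩, rfl⟩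
  | append_singleton w a ih =>
    have h : T.run (w ++ [a]) = T.step (T.run w) a := by simp [SdmSST.run]
    rw [NondetSdmSST.run_append_singleton, ih, h, step_toNondet]

/-- All components are reached, but the output morphism reads exactly one of them. -/
theorem eval_toNondet (w : List A) : T.toNondet.eval w = {T.eval w} := by
  ext x
  simp only [NondetSdmSST.eval, run_toNondet, SdmSST.eval, Set.mem_ofPred_eq,
    Set.mem_singleton_iff]
  generalize T.run w = c
  have key : ∀ y (g : T.memObj ⟨c.1, y⟩ ⟶ 𝔠.final), T.outMor c.1 () = ⟨y, g⟩ →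
      𝔠.withProd.interp (c.2 ≫ T.outMor c.1) = 𝔠.interp ((c.2 y).2 ≫ g) := by
    intro y g h
    change 𝔠.interp ((c.2 (T.outMor c.1 ()).1).2 ≫ (T.outMor c.1 ()).2) = _
    rw [h]
  constructor
  · rintro ⟨_, ⟨y, rfl⟩, g, hg, rfl⟩
    exact (key y g ((T.outMor_toNondet_eq_some_iff _ g).1 hg)).symm
  · rintro rfl
    exact ⟨_, ⟨(T.outMor c.1 ()).1, rfl⟩, _, (T.outMor_toNondet_eq_some_iff _ _).2 rfl, key _ _ rfl⟩

end SdmSST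

theorem SdmSST.exists_copylessSST {A : Type w'} {B : Type w} [Finite A]
    (T : SdmSST (SR B).withProd A) : ∃ T' : CopylessSST A B, T'.eval = T.eval := by
  obtain ⟨T', F, h⟩ := T.toNondet.exists_copylessSST
  refine ⟨T', funext fun w => ?_⟩
  have := (h w).2 ((h w).1.2 (by rw [eval_toNondet]; exact Set.singleton_nonempty _))
  rwa [eval_toNondet] at this

theorem mainTheorem7 (A : Type w') (B : Type w) [Finite A] [Finite B] :
    (∀ T : SdmSST (SR B).withProd A, ∃ T' : SdmSST (SR B) A, T'.eval = T.eval) ∧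
    (∀ T : SdmSST (SR B).withProd A, ∃ T' : CopylessSST A B, T'.eval = T.eval) ∧
    (∀ N : NondetSdmSST (SR B) A, ∃ P : PartialSdmSST (SR B) A,
      P.ConstMemory ∧ Uniformizes P.eval N.eval) := by
  classical
  refine ⟨fun T => ?_, fun T => T.exists_copylessSST, fun N => ?_⟩
  · obtain ⟨T', h⟩ := T.exists_copylessSST
    exact ⟨T'.toSdmSST, T'.eval_toSdmSST.trans h⟩
  · obtain ⟨T, F, h⟩ := N.exists_copylessSST
    refine ⟨T.toPartialSdmSST F, ⟨⟨T.Reg⟩, fun _ => rfl⟩, fun w => ?_, fun w x hx => ?_⟩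
    · rw [T.eval_toPartialSdmSST, ← (h w).1]
      split_ifs with hF <;> simp [hF]
    · rw [T.eval_toPartialSdmSST] at hx
      split_ifs at hx with hF
      cases hx
      exact (h w).2 hF
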